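/- Let $\alpha>-1$ and $t\in\mathbb R$, let $w(x,t)=(1-x^2)^{\alpha}e^{-tx^2}$ for $x\in[-1,1]$, and let $P_n(x,t)$ be the monic polynomial of degree $n$ ($n\ge 0$) of the system orthogonal with respect to $w(\cdot,t)$, that is, $\int_{-1}^1P_mP_nw\,dx=h_n(t)\delta_{mn}$. Let $\mu_j(t)=\int_{-1}^1x^jw(x,t)\,dx$ and $D_n(t)=\det(\mu_{j+k}(t))_{j,k=0}^{n-1}$, with $D_0=1$. (The polynomials exist and are unique, $h_n(t)>0$, $D_n(t)>0$ and $D_n$ is differentiable in $t$.) For $\alpha>0$ put $$H_n(t)=\sum_{j=0}^{n-1}R_j(t),\qquad R_n(t)=\frac{2\alpha}{h_n(t)}\int_{-1}^{1}\frac{P_n^2(y,t)\,w(y,t)}{1-y^2}\,dy ,$$ where the integrals converge; in that case $$H_n(t)=n(n+2\alpha)+2t\frac{d}{dt}\ln D_n(t),$$ and for $-1<\alpha\le 0$, where the definition through $R_j$ is not available, the last formula is taken as the definition of $H_n(t)$. Then $H_0(t)=0$ and for every $n\ge 1$ $$\begin{aligned}0={}&(2t+H_n-H_{n-1})^2(2t+H_{n+1}-H_n)^2(H_n+nH_{n-1}-nH_{n+1})\\&+\big[n(2t+H_n-H_{n-1})(2t+H_{n+1}-H_n)-2t(2nt+H_n)\big]\\&\times\big[(2t+H_n-H_{n-1})(2t+H_{n+1}-H_n)(2t-n-2\alpha+H_{n+1}-H_{n-1})+2t(2nt+H_n)\big].\end{aligned}$$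 Moreover, with $\Phi(a,b;z)=\sum_{k\ge 0}\frac{(a)_k}{(b)_k}\frac{z^k}{k!}$ Kummer's confluent hypergeometric function, if $\alpha\ne-\tfrac12$ (for $\alpha=-\tfrac12$ the function $\Phi(\tfrac12,\tfrac12+\alpha;-t)$ is undefined) then $$H_1(t)=\frac{(1+2\alpha)\,\Phi\left(\frac12,\frac12+\alpha;-t\right)}{\Phi\left(\frac12,\frac32+\alpha;-t\right)},\qquad H_2(t)=\frac{(1+2\alpha)\,\Phi\left(\frac12,\frac12+\alpha;-t\right)}{\Phi\left(\frac12,\frac32+\alpha;-t\right)}+\frac{(3+2\alpha)\,\Phi\left(\frac32,\frac32+\alpha;-t\right)}{\Phi\left(\frac32,\frac52+\alpha;-t\right)},$$ where the denominators $\Phi(\frac12,\frac32+\alpha;-t)$ and $\Phi(\frac32,\frac52+\alpha;-t)$ are nonzero. -/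

import Mathlib

open MeasureTheory Polynomial

namespace SemiJacobi

/-- Kummer's confluent hypergeometric function
`Φ(a, b; z) = ∑ₖ (a)ₖ / (b)ₖ * zᵏ / k!`, for `b ≠ 0, -1, -2, …`. -/
noncomputable def kummer (a b z : ℝ) : ℝ :=
  ∑' k : ℕ, (ascPochhammer ℝ k).eval a / (ascPochhammer ℝ k).eval b * (z ^ k / (k.factorial : ℝ))

/-- The series defining `kummer` converges for all `z` when `b` is admissible. -/
theorem summable_kummer (a b z : ℝ) (hb : ∀ k : ℕ, b ≠ -(k : ℝ)) :
    Summable fun k : ℕ =>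
      (ascPochhammer ℝ k).eval a / (ascPochhammer ℝ k).eval b * (z ^ k / (k.factorial : ℝ)) := by
  have hlim : Filter.Tendsto (fun k : ℕ => (a + k) / (b + k) * (z / ((k : ℝ) + 1)))
      Filter.atTop (nhds 0) := by
    have h1 : Filter.Tendsto (fun k : ℕ => (a + k) / (b + k)) Filter.atTop (nhds (1 : ℝ)) := by
      have h := tendsto_add_mul_div_add_mul_atTop_nhds (𝕜 := ℝ) a b 1 (d := 1) one_ne_zero
      simpa using h
    have h2 : Filter.Tendsto (fun k : ℕ => z / ((k : ℝ) + 1)) Filter.atTop (nhds (0 : ℝ)) :=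
      tendsto_const_nhds.div_atTop
        (Filter.tendsto_atTop_add_const_right _ _ tendsto_natCast_atTop_atTop)
    simpa using h1.mul h2
  have hev : ∀ᶠ k : ℕ in Filter.atTop, ‖(a + k) / (b + k) * (z / ((k : ℝ) + 1))‖ ≤ 1 / 2 := by
    have h := hlim.norm
    rw [norm_zero] at h
    exact h.eventually (ge_mem_nhds (by norm_num))
  refine summable_of_ratio_norm_eventually_le (r := 1 / 2) (by norm_num) ?_
  filter_upwards [hev] with k hk
  have hbk : b + k ≠ 0 := fun h => hb k (by linarith)
  have hstep : (ascPochhammer ℝ (k + 1)).eval a / (ascPochhammer ℝ (k + 1)).eval b *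
      (z ^ (k + 1) / ((k + 1).factorial : ℝ)) =
      ((a + k) / (b + k) * (z / ((k : ℝ) + 1))) *
      ((ascPochhammer ℝ k).eval a / (ascPochhammer ℝ k).eval b * (z ^ k / (k.factorial : ℝ))) := by
    rw [ascPochhammer_succ_eval, ascPochhammer_succ_eval, Nat.factorial_succ, pow_succ]
    push_cast
    rw [mul_div_mul_comm, mul_comm ((k : ℝ) + 1), mul_div_mul_comm]
    ring
  rw [hstep, norm_mul]
  exact mul_le_mul_of_nonneg_right hk (norm_nonneg _)

/-- The symmetric semi-classical Jacobi weight `w(x, t) = (1 - x²)^α exp(-t x²)` on `[-1, 1]`. -/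
noncomputable def weight (α t x : ℝ) : ℝ :=
  (1 - x ^ 2) ^ α * Real.exp (-t * x ^ 2)

/-- The moments `μⱼ(t)`. -/
noncomputable def moment (α t : ℝ) (j : ℕ) : ℝ :=
  ∫ x in (-1 : ℝ)..1, x ^ j * weight α t x

/-- The Hankel determinant `Dₙ(t) = det (μ_{j+k}(t))_{j,k=0}^{n-1}`. -/
noncomputable def hankelDet (α : ℝ) (n : ℕ) (t : ℝ) : ℝ :=
  (Matrix.of fun j k : Fin n => moment α t ((j : ℕ) + (k : ℕ))).det

/-- `P` is the sequence of monic polynomials, `P n` of degree `n`, that are orthogonal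
with respect to the weight `w(·, t)` on `[-1, 1]`. -/
def IsMonicOrthogonal (α t : ℝ) (P : ℕ → ℝ[X]) : Prop :=
  (∀ n, (P n).Monic ∧ (P n).natDegree = n) ∧
  ∀ m n, m ≠ n → ∫ x in (-1 : ℝ)..1, (P m).eval x * (P n).eval x * weight α t x = 0

/-- `hₙ(t) = ∫ Pₙ(x, t)² w(x, t) dx`. -/
noncomputable def normSq (α t : ℝ) (P : ℕ → ℝ[X]) (n : ℕ) : ℝ :=
  ∫ x in (-1 : ℝ)..1, (P n).eval x ^ 2 * weight α t x

/-- `Rₙ(t) = (2 α / hₙ(t)) ∫ (1 - y²)⁻¹ Pₙ(y, t)² w(y, t) dy`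
(the integral converges when `α > 0`). -/
noncomputable def auxR (α t : ℝ) (P : ℕ → ℝ[X]) (n : ℕ) : ℝ :=
  2 * α / normSq α t P n *
    ∫ y in (-1 : ℝ)..1, 1 / (1 - y ^ 2) * (P n).eval y ^ 2 * weight α t y

/-- `∑_{j=0}^{n-1} Rⱼ(t)`. -/
noncomputable def sumR (α t : ℝ) (P : ℕ → ℝ[X]) (n : ℕ) : ℝ :=
  ∑ j ∈ Finset.range n, auxR α t P j

/-- `n (n + 2 α) + 2 t (d/dt) ln Dₙ(t)`. -/
noncomputable def logDerivH (α t : ℝ) (n : ℕ) : ℝ :=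
  n * (n + 2 * α) + 2 * t * deriv (fun s : ℝ => Real.log (hankelDet α n s)) t

/-- `H` is the sequence `n ↦ Hₙ(t)`: the sum of the `Rⱼ(t)` with `j < n`, available for `α > 0`,
or, for every `α > -1`, the expression through the logarithmic derivative of the Hankel
determinant. -/
def IsHankelQuantity (α t : ℝ) (H : ℕ → ℝ) : Prop :=
  (0 < α ∧ ∃ P, IsMonicOrthogonal α t P ∧ ∀ n, H n = sumR α t P n) ∨
  (∀ n, H n = logDerivH α t n)

end SemiJacobi

/-!
Fix `t` and write `L p = ∫ p w(x, t) dx`. Since `L` is positive definite and invariant under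
`x ↦ -x`, its monic orthogonal polynomials satisfy `x Pₙ = Pₙ₊₁ + βₙ Pₙ₋₁` with `βₙ = hₙ / hₙ₋₁`
and `β₀ = 0`; existence of the system is proved by taking this recurrence as the definition
(`orthPoly`), and uniqueness is `IsSymmetricPositive.eq_orthPoly`.

Everything is expressed through the `βₙ`. Put
`Rₙ = 2 n + 1 + 2 α - 2 t (βₙ + βₙ₊₁)` (`coeffR`) and `rₙ = n - 2 t βₙ`.

* Evaluating the Gram matrix at time `s` in the basis of polynomials orthogonal at time `t` gives
  `(ln Dₙ)' = -∑ (βⱼ + βⱼ₊₁)`, hence `Hₙ = ∑ Rⱼ` over `j < n` for every `α > -1`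
  (`logDerivH_eq_sum`). For `α > 0` integrating `(x Pₙ² w)'` identifies `Rₙ` with the quantity
  defined by the integral against `1 / (1 - y²)` (`auxR_eq_coeffR`).
* Because `(1 - x²) w` vanishes at `±1`, the functional satisfies a Pearson identity
  (`isPearson_weightFunctional`). Applied to `Pₙ₋₁ Pₙ`, it gives a nonlinear difference equation
  for the `βₙ` (`IsSymmetricPositive.string_equation`) that is valid for every `α > -1`.
* That equation implies `rₙ (rₙ + 2 α) = βₙ Rₙ Rₙ₋₁` by telescoping (`first_integral`), and,
  multiplied by `2 t`, it is an expression for `Hₙ`. Together they yield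
  `2 n t + Hₙ = βₙ (2 t + Rₙ) (2 t + Rₙ₋₁)`, from which `βₙ` is eliminated
  (`difference_equation`).
* For `n ≤ 1`, `Rₙ` involves only moments. The even moments are multiples of Kummer functions
  (`moment_eq_kummer`), because their ratios at `t = 0` follow from the Pearson identity, and a
  contiguous relation (`kummer_contiguous`) puts `R₀` and `R₁` into the stated form.
-/

namespace SemiJacobi

/-! ### Orthogonal polynomials of a symmetric positive functional -/

/-- A linear functional on real polynomials that is positive definite and invariant under
`x ↦ -x`. -/
structure IsSymmetricPositive (L : ℝ[X] →ₗ[ℝ] ℝ) : Prop where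
  pos : ∀ p : ℝ[X], p ≠ 0 → 0 < L (p * p)
  symm : ∀ p : ℝ[X], L (p.comp (-X)) = L p

/-- The monic orthogonal polynomials of a symmetric functional `L`, built by the three-term
recurrence `Pₙ₊₂ = X Pₙ₊₁ - (hₙ₊₁ / hₙ) Pₙ`, where `hₙ = L (Pₙ²)`. -/
noncomputable def orthPoly (L : ℝ[X] →ₗ[ℝ] ℝ) : ℕ → ℝ[X]
  | 0 => 1
  | 1 => X
  | n + 2 => X * orthPoly L (n + 1) -
      C (L (orthPoly L (n + 1) * orthPoly L (n + 1)) / L (orthPoly L n * orthPoly L n)) *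
        orthPoly L n

/-- The squared norm `hₙ = L (Pₙ²)`. -/
noncomputable def orthNorm (L : ℝ[X] →ₗ[ℝ] ℝ) (n : ℕ) : ℝ :=
  L (orthPoly L n * orthPoly L n)

/-- The recurrence coefficient `βₙ = hₙ / hₙ₋₁`, with the convention `β₀ = 0`. -/
noncomputable def recCoeff (L : ℝ[X] →ₗ[ℝ] ℝ) : ℕ → ℝ
  | 0 => 0
  | n + 1 => orthNorm L (n + 1) / orthNorm L n

theorem apply_C_mul (L : ℝ[X] →ₗ[ℝ] ℝ) (c : ℝ) (p : ℝ[X]) : L (C c * p) = c * L p := by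
  rw [← smul_eq_C_mul, map_smul, smul_eq_mul]

/-- The recurrence in the form valid for all `n`; for `n = 0` the last term vanishes because
`β₀ = 0`. -/
theorem X_mul_orthPoly (L : ℝ[X] →ₗ[ℝ] ℝ) (n : ℕ) :
    X * orthPoly L n = orthPoly L (n + 1) + C (recCoeff L n) * orthPoly L (n - 1) := by
  cases n with
  | zero => simp [orthPoly, recCoeff]
  | succ n => simp [orthPoly, recCoeff, orthNorm]

theorem orthPoly_add_two (L : ℝ[X] →ₗ[ℝ] ℝ) (n : ℕ) :
    orthPoly L (n + 2) = X * orthPoly L (n + 1) - C (recCoeff L (n + 1)) * orthPoly L n := by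
  rw [X_mul_orthPoly]; simp

theorem orthPoly_monic_natDegree (L : ℝ[X] →ₗ[ℝ] ℝ) (n : ℕ) :
    (orthPoly L n).Monic ∧ (orthPoly L n).natDegree = n := by
  induction n using Nat.twoStepInduction with
  | zero => simp [orthPoly]
  | one => simp [orthPoly]
  | more n ih0 ih1 =>
    have hX : (X * orthPoly L (n + 1)).Monic := monic_X.mul ih1.1
    have hd : (X * orthPoly L (n + 1)).natDegree = n + 2 := by
      rw [monic_X.natDegree_mul ih1.1, ih1.2, natDegree_X]; omega
    have hlt : (C (recCoeff L (n + 1)) * orthPoly L n).degree <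
        (X * orthPoly L (n + 1)).degree := by
      rw [degree_eq_natDegree hX.ne_zero, hd]
      rw [← smul_eq_C_mul]
      refine lt_of_le_of_lt (degree_smul_le _ _) ?_
      rw [degree_eq_natDegree ih0.1.ne_zero, ih0.2]
      exact_mod_cast (by omega : n < n + 2)
    rw [orthPoly_add_two]
    exact ⟨hX.sub_of_left hlt, by rw [natDegree_eq_of_degree_eq
      (degree_sub_eq_left_of_degree_lt hlt), hd]⟩

theorem orthPoly_monic (L : ℝ[X] →ₗ[ℝ] ℝ) (n : ℕ) : (orthPoly L n).Monic :=
  (orthPoly_monic_natDegree L n).1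

theorem natDegree_orthPoly (L : ℝ[X] →ₗ[ℝ] ℝ) (n : ℕ) : (orthPoly L n).natDegree = n :=
  (orthPoly_monic_natDegree L n).2

theorem coeff_orthPoly_self (L : ℝ[X] →ₗ[ℝ] ℝ) (n : ℕ) : (orthPoly L n).coeff n = 1 := by
  have h := (orthPoly_monic L n).coeff_natDegree
  rwa [natDegree_orthPoly] at h

theorem coeff_orthPoly_of_lt (L : ℝ[X] →ₗ[ℝ] ℝ) {n k : ℕ} (h : n < k) :
    (orthPoly L n).coeff k = 0 :=
  coeff_eq_zero_of_natDegree_lt (by rwa [natDegree_orthPoly])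

theorem coeff_orthPoly_succ (L : ℝ[X] →ₗ[ℝ] ℝ) (n : ℕ) : (orthPoly L (n + 1)).coeff n = 0 := by
  induction n with
  | zero => simp [orthPoly]
  | succ n ih =>
    rw [orthPoly_add_two, coeff_sub, coeff_X_mul, ih, coeff_C_mul,
      coeff_orthPoly_of_lt L (Nat.lt_succ_self n)]
    simp

/-- The coefficient of `xⁿ⁻²` in `Pₙ` is `-(β₀ + ⋯ + βₙ₋₁)`. -/
theorem coeff_orthPoly_add_two (L : ℝ[X] →ₗ[ℝ] ℝ) (n : ℕ) :
    (orthPoly L (n + 2)).coeff n = -∑ j ∈ Finset.range (n + 2), recCoeff L j := by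
  induction n with
  | zero =>
    rw [orthPoly_add_two]
    simp [Finset.sum_range_succ, recCoeff, orthPoly]
  | succ n ih =>
    rw [orthPoly_add_two, coeff_sub, coeff_X_mul, ih, coeff_C_mul, coeff_orthPoly_self,
      Finset.sum_range_succ _ (n + 2)]
    ring

theorem orthPoly_comp_neg (L : ℝ[X] →ₗ[ℝ] ℝ) (n : ℕ) :
    (orthPoly L n).comp (-X) = (-1) ^ n * orthPoly L n := by
  induction n using Nat.twoStepInduction with
  | zero => simp [orthPoly]
  | one => simp [orthPoly]
  | more n ih0 ih1 =>
    rw [orthPoly_add_two, sub_comp, mul_comp, mul_comp, ih0, ih1, X_comp, C_comp]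
    ring

namespace IsSymmetricPositive

variable {L : ℝ[X] →ₗ[ℝ] ℝ}

theorem orthNorm_pos (hL : IsSymmetricPositive L) (n : ℕ) : 0 < orthNorm L n :=
  hL.pos _ (orthPoly_monic L n).ne_zero

theorem orthNorm_succ (hL : IsSymmetricPositive L) (n : ℕ) :
    orthNorm L (n + 1) = recCoeff L (n + 1) * orthNorm L n := by
  rw [recCoeff, div_mul_cancel₀ _ (hL.orthNorm_pos n).ne']

/-- By parity, `L (x Pₙ²) = 0`. -/
theorem apply_X_mul_orthPoly_sq (hL : IsSymmetricPositive L) (n : ℕ) :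
    L (X * orthPoly L n * orthPoly L n) = 0 := by
  have h := hL.symm (X * orthPoly L n * orthPoly L n)
  have e : (X * orthPoly L n * orthPoly L n).comp (-X) = -(X * orthPoly L n * orthPoly L n) := by
    rw [mul_comp, mul_comp, orthPoly_comp_neg, X_comp]
    have : ((-1 : ℝ[X]) ^ n) * (-1) ^ n = 1 := by rw [← mul_pow]; simp
    linear_combination (-X * orthPoly L n * orthPoly L n) * this
  rw [e, map_neg] at h
  linarith

theorem apply_mul_orthPoly_of_lt (hL : IsSymmetricPositive L) {m n : ℕ} (hmn : m < n) :
    L (orthPoly L m * orthPoly L n) = 0 := by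
  induction n using Nat.strong_induction_on generalizing m with
  | _ n ih =>
    match n, hmn with
    | 1, hmn =>
      obtain rfl : m = 0 := by omega
      have h := hL.apply_X_mul_orthPoly_sq 0
      simpa [orthPoly] using h
    | n + 2, hmn =>
      have hrec : L (orthPoly L m * orthPoly L (n + 2)) =
          L (X * orthPoly L m * orthPoly L (n + 1)) -
            recCoeff L (n + 1) * L (orthPoly L m * orthPoly L n) := by
        rw [← apply_C_mul, ← map_sub, orthPoly_add_two]
        congr 1; ring
      have hexp : L (X * orthPoly L m * orthPoly L (n + 1)) =
          L (orthPoly L (m + 1) * orthPoly L (n + 1)) +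
            recCoeff L m * L (orthPoly L (m - 1) * orthPoly L (n + 1)) := by
        rw [← apply_C_mul, ← map_add, X_mul_orthPoly]
        congr 1; ring
      rcases (by omega : m < n ∨ m = n ∨ m = n + 1) with h | h | h
      · rw [hrec, hexp, ih (n + 1) (by omega) (by omega), ih (n + 1) (by omega) (by omega),
          ih n (by omega) h]
        simp
      · subst h
        have h0 : recCoeff L m * L (orthPoly L (m - 1) * orthPoly L (m + 1)) = 0 := by
          cases m with
          | zero => simp [recCoeff]
          | succ m => rw [ih (m + 1 + 1) (by omega) (by omega), mul_zero]
        rw [hrec, hexp, h0]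
        change orthNorm L (m + 1) + _ - _ * orthNorm L m = 0
        rw [hL.orthNorm_succ]; ring
      · subst h
        rw [hrec, hL.apply_X_mul_orthPoly_sq, mul_comm (orthPoly L (n + 1)),
          ih (n + 1) (by omega) (Nat.lt_succ_self n)]
        simp

theorem apply_mul_orthPoly_of_ne (hL : IsSymmetricPositive L) {m n : ℕ} (hmn : m ≠ n) :
    L (orthPoly L m * orthPoly L n) = 0 := by
  rcases lt_or_gt_of_ne hmn with h | h
  · exact hL.apply_mul_orthPoly_of_lt h
  · rw [mul_comm]; exact hL.apply_mul_orthPoly_of_lt h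

end IsSymmetricPositive

/-- A monic orthogonal sequence is orthogonal to all polynomials of lower degree. -/
theorem apply_mul_eq_zero_of_degree_lt {L : ℝ[X] →ₗ[ℝ] ℝ} {P : ℕ → ℝ[X]}
    (hP : ∀ n, (P n).Monic ∧ (P n).natDegree = n) (hO : ∀ m n, m ≠ n → L (P m * P n) = 0)
    {n : ℕ} {q : ℝ[X]} (hq : ∀ k, n ≤ k → q.coeff k = 0) : L (q * P n) = 0 := by
  suffices H : ∀ d ≤ n, ∀ q : ℝ[X], (∀ k, d ≤ k → q.coeff k = 0) → L (q * P n) = 0 from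
    H n le_rfl q hq
  intro d
  induction d with
  | zero =>
    intro _ q hq
    have : q = 0 := by ext k; simpa using hq k (Nat.zero_le k)
    simp [this]
  | succ d ih =>
    intro hd q hq
    have h := ih (by omega) (q - C (q.coeff d) * P d) (fun k hk => by
      rw [coeff_sub, coeff_C_mul]
      rcases hk.eq_or_lt with rfl | hk
      · have h1 := (hP d).1.coeff_natDegree
        rw [(hP d).2] at h1
        rw [h1]; ring
      · rw [hq k hk, coeff_eq_zero_of_natDegree_lt (p := P d) (by rw [(hP d).2]; exact hk)]; ring)
    rw [sub_mul, map_sub, mul_assoc, apply_C_mul, hO d n (by omega)] at h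
    linarith

theorem coeff_X_mul_derivative (p : ℝ[X]) (k : ℕ) :
    (X * derivative p).coeff k = k * p.coeff k := by
  cases k with
  | zero => simp
  | succ k => rw [coeff_X_mul, coeff_derivative]; push_cast; ring

namespace IsSymmetricPositive

variable {L : ℝ[X] →ₗ[ℝ] ℝ}

/-- If `q` has degree at most `n`, then `L (q Pₙ)` is its coefficient of `xⁿ` times `hₙ`. -/
theorem apply_mul_orthPoly (hL : IsSymmetricPositive L) {n : ℕ} {q : ℝ[X]}
    (hq : ∀ k, n < k → q.coeff k = 0) : L (q * orthPoly L n) = q.coeff n * orthNorm L n := by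
  have h := apply_mul_eq_zero_of_degree_lt (n := n) (q := q - C (q.coeff n) * orthPoly L n)
    (orthPoly_monic_natDegree L) (fun _ _ => hL.apply_mul_orthPoly_of_ne) (fun k hk => by
      rw [coeff_sub, coeff_C_mul]
      rcases hk.eq_or_lt with rfl | hk
      · rw [coeff_orthPoly_self]; ring
      · rw [hq k hk, coeff_orthPoly_of_lt L hk]; ring)
  rw [sub_mul, map_sub, mul_assoc, apply_C_mul] at h
  change _ - _ * orthNorm L n = 0 at h
  linarith

theorem eq_orthPoly (hL : IsSymmetricPositive L) {P : ℕ → ℝ[X]}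
    (hP : ∀ n, (P n).Monic ∧ (P n).natDegree = n) (hO : ∀ m n, m ≠ n → L (P m * P n) = 0) :
    P = orthPoly L := by
  funext n
  by_contra hne
  have hd : ∀ k, n ≤ k → (P n - orthPoly L n).coeff k = 0 := fun k hk => by
    rw [coeff_sub]
    rcases hk.eq_or_lt with rfl | hk
    · have h1 := (hP n).1.coeff_natDegree
      rw [(hP n).2] at h1
      rw [h1, coeff_orthPoly_self, sub_self]
    · rw [coeff_orthPoly_of_lt L hk, coeff_eq_zero_of_natDegree_lt (by rw [(hP n).2]; exact hk),
        sub_self]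
  have h1 := apply_mul_eq_zero_of_degree_lt hP hO hd
  have h2 := apply_mul_eq_zero_of_degree_lt (orthPoly_monic_natDegree L)
    (fun _ _ => hL.apply_mul_orthPoly_of_ne) hd
  have h3 := hL.pos _ (sub_ne_zero.2 hne)
  rw [mul_sub, map_sub, h1, h2] at h3
  simp at h3

/-- `L (x² Pₙ²) = (βₙ + βₙ₊₁) hₙ`. -/
theorem apply_X_sq_mul_orthPoly_sq (hL : IsSymmetricPositive L) (n : ℕ) :
    L (X ^ 2 * (orthPoly L n * orthPoly L n)) =
      (recCoeff L n + recCoeff L (n + 1)) * orthNorm L n := by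
  have e : X ^ 2 * (orthPoly L n * orthPoly L n) =
      (X * orthPoly L n) * (X * orthPoly L n) := by ring
  rw [e, X_mul_orthPoly]
  have e2 : (orthPoly L (n + 1) + C (recCoeff L n) * orthPoly L (n - 1)) *
      (orthPoly L (n + 1) + C (recCoeff L n) * orthPoly L (n - 1)) =
      orthPoly L (n + 1) * orthPoly L (n + 1) +
      C (2 * recCoeff L n) * (orthPoly L (n - 1) * orthPoly L (n + 1)) +
      C (recCoeff L n * recCoeff L n) * (orthPoly L (n - 1) * orthPoly L (n - 1)) := by
    simp only [C_mul, C_ofNat]; ring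
  rw [e2, map_add, map_add, apply_C_mul, apply_C_mul,
    hL.apply_mul_orthPoly_of_lt (by omega : n - 1 < n + 1)]
  change orthNorm L (n + 1) + _ + _ * orthNorm L (n - 1) = _
  rw [hL.orthNorm_succ]
  cases n with
  | zero => simp [recCoeff]
  | succ n => rw [Nat.add_sub_cancel, hL.orthNorm_succ n]; ring

/-- Euler's operator: `L (x Pₙ' Pₙ) = n hₙ`. -/
theorem apply_X_mul_derivative_self (hL : IsSymmetricPositive L) (n : ℕ) :
    L (X * derivative (orthPoly L n) * orthPoly L n) = n * orthNorm L n := by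
  rw [hL.apply_mul_orthPoly, coeff_X_mul_derivative, coeff_orthPoly_self, mul_one]
  intro k hk
  rw [coeff_X_mul_derivative, coeff_orthPoly_of_lt L hk, mul_zero]

theorem apply_derivative_succ (hL : IsSymmetricPositive L) (m : ℕ) :
    L (derivative (orthPoly L (m + 1)) * orthPoly L m) = (m + 1) * orthNorm L m := by
  rw [hL.apply_mul_orthPoly, coeff_derivative, coeff_orthPoly_self, one_mul]
  intro k hk
  rw [coeff_derivative, coeff_orthPoly_of_lt L (by omega), zero_mul]

theorem apply_derivative_mul_succ (hL : IsSymmetricPositive L) (m : ℕ) :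
    L (derivative (orthPoly L m) * orthPoly L (m + 1)) = 0 := by
  rw [hL.apply_mul_orthPoly, coeff_derivative, coeff_orthPoly_of_lt L (by omega), zero_mul,
    zero_mul]
  intro k hk
  rw [coeff_derivative, coeff_orthPoly_of_lt L (by omega), zero_mul]

theorem apply_X_sq_mul_derivative_mul_succ (hL : IsSymmetricPositive L) (m : ℕ) :
    L (X * (X * derivative (orthPoly L m)) * orthPoly L (m + 1)) = m * orthNorm L (m + 1) := by
  rw [hL.apply_mul_orthPoly, coeff_X_mul, coeff_X_mul_derivative, coeff_orthPoly_self, mul_one]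
  intro k hk
  obtain ⟨k, rfl⟩ : ∃ j, k = j + 1 := ⟨k - 1, by omega⟩
  rw [coeff_X_mul, coeff_X_mul_derivative, coeff_orthPoly_of_lt L (by omega), mul_zero]

/-- `x Pₙ' - n Pₙ` has degree at most `n - 2`, which brings in the sub-leading coefficient. -/
theorem apply_X_mul_derivative_add_two (hL : IsSymmetricPositive L) (k : ℕ) :
    L (X * derivative (orthPoly L (k + 2)) * orthPoly L k) =
      2 * (∑ j ∈ Finset.range (k + 2), recCoeff L j) * orthNorm L k := by
  have h := hL.apply_mul_orthPoly (n := k)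
    (q := X * derivative (orthPoly L (k + 2)) - C ((k : ℝ) + 2) * orthPoly L (k + 2))
    (fun i hi => by
      rw [coeff_sub, coeff_X_mul_derivative, coeff_C_mul]
      rcases (by omega : i = k + 1 ∨ i = k + 2 ∨ k + 2 < i) with rfl | rfl | hi
      · rw [coeff_orthPoly_succ]; ring
      · push_cast; ring
      · rw [coeff_orthPoly_of_lt L hi]; ring)
  rw [sub_mul, map_sub, mul_assoc (C _), apply_C_mul, mul_comm (orthPoly L (k + 2)),
    hL.apply_mul_orthPoly_of_lt (by omega), coeff_sub, coeff_X_mul_derivative, coeff_C_mul,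
    coeff_orthPoly_add_two] at h
  linear_combination h

theorem apply_X_sq_mul_derivative_succ (hL : IsSymmetricPositive L) (m : ℕ) :
    L (X ^ 2 * derivative (orthPoly L (m + 1)) * orthPoly L m) = (m + 1) * orthNorm L (m + 1) +
      2 * (∑ j ∈ Finset.range (m + 1), recCoeff L j) * orthNorm L m := by
  have e : X ^ 2 * derivative (orthPoly L (m + 1)) * orthPoly L m =
      X * derivative (orthPoly L (m + 1)) * orthPoly L (m + 1) +
      C (recCoeff L m) * (X * derivative (orthPoly L (m + 1)) * orthPoly L (m - 1)) := by
    linear_combination X * derivative (orthPoly L (m + 1)) * X_mul_orthPoly L m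
  rw [e, map_add, apply_C_mul, hL.apply_X_mul_derivative_self]
  cases m with
  | zero => simp [recCoeff]
  | succ m =>
    rw [Nat.add_sub_cancel, hL.apply_X_mul_derivative_add_two, hL.orthNorm_succ m]
    push_cast; ring

theorem apply_X_mul_succ (hL : IsSymmetricPositive L) (m : ℕ) :
    L (X * orthPoly L m * orthPoly L (m + 1)) = orthNorm L (m + 1) := by
  rw [X_mul_orthPoly, add_mul, map_add, mul_assoc, apply_C_mul,
    hL.apply_mul_orthPoly_of_lt (by omega : m - 1 < m + 1), mul_zero, add_zero, orthNorm]

theorem apply_X_mul_of_lt (hL : IsSymmetricPositive L) {m n : ℕ} (h : m + 1 < n) :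
    L (X * orthPoly L m * orthPoly L n) = 0 := by
  rw [X_mul_orthPoly, add_mul, map_add, mul_assoc, apply_C_mul, hL.apply_mul_orthPoly_of_lt h,
    hL.apply_mul_orthPoly_of_lt (by omega : m - 1 < n), mul_zero, add_zero]

theorem apply_X_cubed_mul_succ (hL : IsSymmetricPositive L) (m : ℕ) :
    L (X ^ 3 * orthPoly L m * orthPoly L (m + 1)) =
      (recCoeff L m + recCoeff L (m + 1) + recCoeff L (m + 2)) * orthNorm L (m + 1) := by
  have e : X ^ 3 * orthPoly L m * orthPoly L (m + 1) =
      X ^ 2 * (orthPoly L (m + 1) * orthPoly L (m + 1)) +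
      C (recCoeff L m) * (X * orthPoly L (m - 1) * orthPoly L (m + 2) +
        C (recCoeff L (m + 1)) * (X * orthPoly L (m - 1) * orthPoly L m)) := by
    have h := X_mul_orthPoly L (m + 1)
    rw [Nat.add_sub_cancel] at h
    linear_combination X ^ 2 * orthPoly L (m + 1) * X_mul_orthPoly L m +
      X * C (recCoeff L m) * orthPoly L (m - 1) * h
  rw [e, map_add, apply_C_mul, map_add, apply_C_mul, hL.apply_X_sq_mul_orthPoly_sq]
  cases m with
  | zero => simp [recCoeff]
  | succ m =>
    rw [Nat.add_sub_cancel, hL.apply_X_mul_succ, hL.apply_X_mul_of_lt (by omega),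
      hL.orthNorm_succ (m + 1)]
    ring

end IsSymmetricPositive

/-! ### The discrete system for the recurrence coefficients -/

/-- The Pearson-type identity of a functional: the distributional form of
`((1 - x²) w)' = -(2 (1 + α) x + 2 t x (1 - x²)) w` for the weight `w = (1 - x²)^α exp(-t x²)`. -/
def IsPearson (α t : ℝ) (L : ℝ[X] →ₗ[ℝ] ℝ) : Prop :=
  ∀ Q : ℝ[X], L ((1 - X ^ 2) * derivative Q) =
    L ((C (2 * (1 + α)) * X + C (2 * t) * X * (1 - X ^ 2)) * Q)

/-- The Pearson identity tested against `Pₘ Pₘ₊₁` is a nonlinear difference equation for the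
recurrence coefficients. -/
theorem IsSymmetricPositive.string_equation {L : ℝ[X] →ₗ[ℝ] ℝ} (hL : IsSymmetricPositive L)
    {α t : ℝ} (hP : IsPearson α t L) (m : ℕ) :
    (m + 1 : ℝ) - 2 * ∑ j ∈ Finset.range (m + 1), recCoeff L j =
      recCoeff L (m + 1) * (2 * m + 3 + 2 * α + 2 * t -
        2 * t * (recCoeff L m + recCoeff L (m + 1) + recCoeff L (m + 2))) := by
  have h := hP (orthPoly L m * orthPoly L (m + 1))
  have e1 : (1 - X ^ 2) * derivative (orthPoly L m * orthPoly L (m + 1)) =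
      derivative (orthPoly L (m + 1)) * orthPoly L m
      + derivative (orthPoly L m) * orthPoly L (m + 1)
      - X * (X * derivative (orthPoly L m)) * orthPoly L (m + 1)
      - X ^ 2 * derivative (orthPoly L (m + 1)) * orthPoly L m := by
    rw [derivative_mul]; ring
  have e2 : (C (2 * (1 + α)) * X + C (2 * t) * X * (1 - X ^ 2)) *
      (orthPoly L m * orthPoly L (m + 1)) =
      C (2 * (1 + α)) * (X * orthPoly L m * orthPoly L (m + 1)) +
      C (2 * t) * (X * orthPoly L m * orthPoly L (m + 1)) -
      C (2 * t) * (X ^ 3 * orthPoly L m * orthPoly L (m + 1)) := by ring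
  rw [e1, e2] at h
  simp only [map_add, map_sub, apply_C_mul, hL.apply_derivative_succ,
    hL.apply_derivative_mul_succ, hL.apply_X_sq_mul_derivative_mul_succ,
    hL.apply_X_sq_mul_derivative_succ, hL.apply_X_mul_succ, hL.apply_X_cubed_mul_succ,
    hL.orthNorm_succ] at h
  have hpos := (hL.orthNorm_pos m).ne'
  refine mul_right_cancel₀ hpos ?_
  linear_combination h

/-- The quantity `Rₙ` expressed through the recurrence coefficients. -/
def coeffR (α t : ℝ) (β : ℕ → ℝ) (n : ℕ) : ℝ :=
  2 * n + 1 + 2 * α - 2 * t * (β n + β (n + 1))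

/-- The discrete first integral `rₙ (rₙ + 2 α) = βₙ Rₙ Rₙ₋₁` with `rₙ = n - 2 t βₙ`. Its increment
in `n` is `Rₙ` times the increment of the string equation. -/
theorem first_integral {α t : ℝ} {β : ℕ → ℝ} (h0 : β 0 = 0)
    (hF : ∀ m : ℕ, (m + 1 : ℝ) - 2 * ∑ j ∈ Finset.range (m + 1), β j =
      β (m + 1) * (2 * m + 3 + 2 * α + 2 * t - 2 * t * (β m + β (m + 1) + β (m + 2)))) (m : ℕ) :
    ((m + 1 : ℝ) - 2 * t * β (m + 1)) * ((m + 1 : ℝ) - 2 * t * β (m + 1) + 2 * α) =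
      β (m + 1) * coeffR α t β (m + 1) * coeffR α t β m := by
  induction m with
  | zero =>
    have h := hF 0
    simp only [coeffR, h0, Finset.sum_range_succ, Finset.sum_range_zero] at h ⊢
    push_cast at h ⊢
    linear_combination (1 + 2 * α - 2 * t * β 1) * h
  | succ m ih =>
    have h1 := hF m
    have h2 := hF (m + 1)
    rw [Finset.sum_range_succ] at h2
    simp only [coeffR] at ih ⊢
    push_cast at h2 ih ⊢
    linear_combination ih +
      (2 * (m + 1) + 1 + 2 * α - 2 * t * (β (m + 1) + β (m + 2))) * (h2 - h1)

theorem sum_coeffR {α t : ℝ} {β : ℕ → ℝ} (h0 : β 0 = 0) (n : ℕ) :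
    ∑ j ∈ Finset.range n, coeffR α t β j =
      n * (n + 2 * α) - 2 * t * (2 * ∑ j ∈ Finset.range n, β j + β n) := by
  induction n with
  | zero => simp [h0]
  | succ n ih =>
    rw [Finset.sum_range_succ, ih, Finset.sum_range_succ, coeffR]
    push_cast; ring

/-- With `rₙ = n - 2 t βₙ`, the string equation and the first integral give
`2 n t + Hₙ = βₙ (2 t + Rₙ) (2 t + Rₙ₋₁)`; eliminating `βₙ` and `rₙ` leaves an equation in
`Hₙ₋₁, Hₙ, Hₙ₊₁` alone. -/
theorem difference_equation {α t : ℝ} {β H : ℕ → ℝ} (h0 : β 0 = 0)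
    (hF : ∀ m : ℕ, (m + 1 : ℝ) - 2 * ∑ j ∈ Finset.range (m + 1), β j =
      β (m + 1) * (2 * m + 3 + 2 * α + 2 * t - 2 * t * (β m + β (m + 1) + β (m + 2))))
    (hH : ∀ n, H n = ∑ j ∈ Finset.range n, coeffR α t β j) (n : ℕ) (hn : 1 ≤ n) :
    0 = (2 * t + H n - H (n - 1)) ^ 2 * (2 * t + H (n + 1) - H n) ^ 2
          * (H n + n * H (n - 1) - n * H (n + 1))
      + (n * (2 * t + H n - H (n - 1)) * (2 * t + H (n + 1) - H n)
          - 2 * t * (2 * n * t + H n))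
        * ((2 * t + H n - H (n - 1)) * (2 * t + H (n + 1) - H n)
            * (2 * t - n - 2 * α + H (n + 1) - H (n - 1))
          + 2 * t * (2 * n * t + H n)) := by
  obtain ⟨m, rfl⟩ : ∃ m, n = m + 1 := ⟨n - 1, by omega⟩
  rw [Nat.add_sub_cancel]
  have hm : H (m + 1) - H m = coeffR α t β m := by rw [hH, hH, Finset.sum_range_succ]; ring
  have hm' : H (m + 1 + 1) - H (m + 1) = coeffR α t β (m + 1) := by
    rw [hH, hH, Finset.sum_range_succ _ (m + 1)]; ring
  have hint := first_integral h0 hF m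
  have hstr : -((m + 1 : ℝ) - 2 * t * β (m + 1)) * ((m + 1 : ℝ) - 2 * t * β (m + 1) + 2 * α)
      + 2 * t * ((m + 1 : ℝ) - 2 * t * β (m + 1)) + H (m + 1) =
      2 * t * β (m + 1) * (coeffR α t β (m + 1) + coeffR α t β m) := by
    have h := hF m
    rw [hH, sum_coeffR h0]
    simp only [coeffR]
    push_cast
    linear_combination 2 * t * h
  generalize coeffR α t β m = A at *
  generalize coeffR α t β (m + 1) = B at *
  generalize β (m + 1) = b at *
  obtain rfl : A = H (m + 1) - H m := hm.symm
  obtain rfl : B = H (m + 1 + 1) - H (m + 1) := hm'.symm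
  have hprod : 2 * (m + 1 : ℝ) * t + H (m + 1) =
      b * (2 * t + H (m + 1) - H m) * (2 * t + H (m + 1 + 1) - H (m + 1)) := by
    linear_combination hstr + hint
  push_cast
  rw [hprod]
  linear_combination (2 * t + H (m + 1) - H m) ^ 2 * (2 * t + H (m + 1 + 1) - H (m + 1)) ^ 2 * -hstr

/-! ### The weight and its moment functional -/

theorem weight_nonneg (α t : ℝ) {x : ℝ} (hx : x ∈ Set.Icc (-1 : ℝ) 1) : 0 ≤ weight α t x := by
  have : 0 ≤ 1 - x ^ 2 := by nlinarith [hx.1, hx.2]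
  exact mul_nonneg (Real.rpow_nonneg this α) (Real.exp_pos _).le

theorem one_sub_sq_pos {x : ℝ} (hx : x ∈ Set.Ioo (-1 : ℝ) 1) : 0 < 1 - x ^ 2 := by
  nlinarith [hx.1, hx.2]

theorem weight_pos (α t : ℝ) {x : ℝ} (hx : x ∈ Set.Ioo (-1 : ℝ) 1) : 0 < weight α t x :=
  mul_pos (Real.rpow_pos_of_pos (one_sub_sq_pos hx) α) (Real.exp_pos _)

theorem weight_neg (α t x : ℝ) : weight α t (-x) = weight α t x := by
  simp [weight]

theorem weight_eq_mul_exp (α t x : ℝ) : weight α t x = Real.exp (-t * x ^ 2) * weight α 0 x := by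
  simp [weight, mul_comm]

theorem weight_add_one (α t : ℝ) {x : ℝ} (hx : x ∈ Set.Ioo (-1 : ℝ) 1) :
    weight (α + 1) t x = (1 - x ^ 2) * weight α t x := by
  rw [weight, weight, Real.rpow_add_one (one_sub_sq_pos hx).ne']
  ring

theorem intervalIntegrable_weight {α : ℝ} (hα : -1 < α) (t : ℝ) :
    IntervalIntegrable (weight α t) volume (-1) 1 := by
  have h1 : IntervalIntegrable (fun x : ℝ => (1 - x) ^ α) volume 0 1 := by
    simpa using (intervalIntegral.intervalIntegrable_rpow' hα (a := 1) (b := 0)).comp_sub_left 1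
  have h2 : IntervalIntegrable
      (fun x : ℝ => (1 - x) ^ α * ((1 + x) ^ α * Real.exp (-t * x ^ 2))) volume 0 1 := by
    refine h1.mul_continuousOn (ContinuousOn.mul ?_ (by fun_prop))
    refine ContinuousOn.rpow_const (by fun_prop) (fun x hx => Or.inl ?_)
    rw [Set.uIcc_of_le zero_le_one] at hx
    linarith [hx.1]
  have h3 : IntervalIntegrable (weight α t) volume 0 1 := by
    refine h2.congr (fun x hx => ?_)
    rw [Set.uIoc_of_le zero_le_one] at hx
    have : 1 - x ^ 2 = (1 - x) * (1 + x) := by ring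
    simp only [weight]
    rw [this, Real.mul_rpow (by linarith [hx.2]) (by linarith [hx.1])]
    ring
  have h4 : IntervalIntegrable (weight α t) volume (-1) 0 := by
    rw [IntervalIntegrable.iff_comp_neg]
    simpa [weight_neg] using h3.symm
  exact h4.trans h3

theorem intervalIntegrable_mul_weight {α : ℝ} (hα : -1 < α) (t : ℝ) {f : ℝ → ℝ}
    (hf : Continuous f) : IntervalIntegrable (fun x => f x * weight α t x) volume (-1) 1 :=
  (intervalIntegrable_weight hα t).continuousOn_mul hf.continuousOn

theorem integral_congr_Ioo {f g : ℝ → ℝ} (h : ∀ x ∈ Set.Ioo (-1 : ℝ) 1, f x = g x) :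
    ∫ x in (-1 : ℝ)..1, f x = ∫ x in (-1 : ℝ)..1, g x := by
  rw [intervalIntegral.integral_of_le (by norm_num), intervalIntegral.integral_of_le (by norm_num),
    integral_Ioc_eq_integral_Ioo, integral_Ioc_eq_integral_Ioo]
  exact setIntegral_congr_fun measurableSet_Ioo h

theorem intervalIntegrable_congr_Ioo {f g : ℝ → ℝ} (h : ∀ x ∈ Set.Ioo (-1 : ℝ) 1, f x = g x)
    (hf : IntervalIntegrable f volume (-1) 1) : IntervalIntegrable g volume (-1) 1 := by
  rw [intervalIntegrable_iff_integrableOn_Ioo_of_le (by norm_num)] at hf ⊢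
  exact hf.congr_fun h measurableSet_Ioo

/-- The moment functional `p ↦ ∫ p(x) w(x, t) dx`; the hypothesis `-1 < α` makes the integrals
converge, so that the functional is linear. -/
noncomputable def weightFunctional {α : ℝ} (hα : -1 < α) (t : ℝ) : ℝ[X] →ₗ[ℝ] ℝ where
  toFun p := ∫ x in (-1 : ℝ)..1, p.eval x * weight α t x
  map_add' p q := by
    rw [← intervalIntegral.integral_add (intervalIntegrable_mul_weight hα t p.continuous)
      (intervalIntegrable_mul_weight hα t q.continuous)]
    simp [add_mul]
  map_smul' c p := by
    rw [RingHom.id_apply, smul_eq_mul, ← intervalIntegral.integral_const_mul]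
    simp [mul_assoc]

theorem weightFunctional_apply {α : ℝ} (hα : -1 < α) (t : ℝ) (p : ℝ[X]) :
    weightFunctional hα t p = ∫ x in (-1 : ℝ)..1, p.eval x * weight α t x := rfl

theorem weightFunctional_X_pow {α : ℝ} (hα : -1 < α) (t : ℝ) (j : ℕ) :
    weightFunctional hα t (X ^ j) = moment α t j := by
  simp [weightFunctional_apply, moment]

theorem isSymmetricPositive_weightFunctional {α : ℝ} (hα : -1 < α) (t : ℝ) :
    IsSymmetricPositive (weightFunctional hα t) where
  pos p hp := by
    have hint := intervalIntegrable_mul_weight hα t (p * p).continuous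
    rw [weightFunctional_apply,
      intervalIntegral.integral_pos_iff_support_of_nonneg_ae' _ hint]
    · refine ⟨by norm_num, ?_⟩
      have hfin : ({x | p.IsRoot x} : Set ℝ).Finite := finite_setOfPred_isRoot hp
      have hsub : Set.Ioo (-1 : ℝ) 1 \ {x | p.IsRoot x} ⊆
          Function.support (fun x => (p * p).eval x * weight α t x) ∩ Set.Ioc (-1) 1 := by
        rintro x ⟨hx, hr⟩
        refine ⟨?_, hx.1, hx.2.le⟩
        have hr' : p.eval x ≠ 0 := hr
        simp only [Function.mem_support, eval_mul]
        exact mul_ne_zero (mul_ne_zero hr' hr') (weight_pos α t hx).ne'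
      refine lt_of_lt_of_le ?_ (measure_mono hsub)
      rw [measure_sdiff_null (hfin.measure_zero volume), Real.volume_Ioo]
      norm_num
    · rw [Set.uIoc_of_le (by norm_num : (-1 : ℝ) ≤ 1)]
      refine (ae_restrict_mem measurableSet_Ioc).mono (fun x hx => ?_)
      simp only [eval_mul, Pi.zero_apply]
      exact mul_nonneg (mul_self_nonneg _) (weight_nonneg α t ⟨hx.1.le, hx.2⟩)
  symm p := by
    have h := intervalIntegral.integral_comp_neg (a := -1) (b := 1)
      (fun x => p.eval x * weight α t x)
    simpa [weightFunctional_apply, weight_neg] using h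

theorem weightFunctional_add_one {α : ℝ} (hα : -1 < α) (hα' : -1 < α + 1) (t : ℝ) (p : ℝ[X]) :
    weightFunctional hα' t p = weightFunctional hα t ((1 - X ^ 2) * p) := by
  rw [weightFunctional_apply, weightFunctional_apply]
  refine integral_congr_Ioo (fun x hx => ?_)
  rw [weight_add_one α t hx]
  simp only [eval_mul, eval_sub, eval_one, eval_pow, eval_X]
  ring

theorem hasDerivAt_weight_add_one (α t : ℝ) {x : ℝ} (hx : x ∈ Set.Ioo (-1 : ℝ) 1) :
    HasDerivAt (weight (α + 1) t)
      (-(2 * (α + 1) * x * weight α t x) - 2 * t * x * weight (α + 1) t x) x := by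
  have h1 : HasDerivAt (fun y : ℝ => 1 - y ^ 2) (-(2 * x)) x := by
    simpa using ((hasDerivAt_id x).pow 2).const_sub 1
  have h2 := h1.rpow_const (p := α + 1) (Or.inl (one_sub_sq_pos hx).ne')
  have h3 : HasDerivAt (fun y : ℝ => Real.exp (-t * y ^ 2))
      (Real.exp (-t * x ^ 2) * (-t * (2 * x))) x := by
    simpa using (((hasDerivAt_id x).pow 2).const_mul (-t)).exp
  refine (h2.mul h3).congr_deriv ?_
  simp only [weight, add_sub_cancel_right]
  ring

/-- Integration by parts against `w_{α+1}`, whose boundary values vanish. -/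
theorem weightFunctional_derivative {α : ℝ} (hα : -1 < α) (hα' : -1 < α + 1) (t : ℝ) (Q : ℝ[X]) :
    weightFunctional hα' t (derivative Q) =
      2 * (α + 1) * weightFunctional hα t (X * Q) + 2 * t * weightFunctional hα' t (X * Q) := by
  have i1 := intervalIntegrable_mul_weight hα' t (derivative Q).continuous
  have i2 := (intervalIntegrable_mul_weight hα t (X * Q).continuous).const_mul (2 * (α + 1))
  have i3 := (intervalIntegrable_mul_weight hα' t (X * Q).continuous).const_mul (2 * t)
  have hcont : ContinuousOn (fun x => Q.eval x * weight (α + 1) t x) (Set.Icc (-1) 1) := by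
    refine Q.continuous.continuousOn.mul (ContinuousOn.mul ?_ (by fun_prop))
    exact ContinuousOn.rpow_const (by fun_prop) (fun x hx => Or.inr (by linarith))
  have hderiv : ∀ x ∈ Set.Ioo (-1 : ℝ) 1, HasDerivAt (fun x => Q.eval x * weight (α + 1) t x)
      (((derivative Q).eval x * weight (α + 1) t x -
        2 * (α + 1) * ((X * Q).eval x * weight α t x)) -
        2 * t * ((X * Q).eval x * weight (α + 1) t x)) x := fun x hx => by
    refine ((Q.hasDerivAt x).mul (hasDerivAt_weight_add_one α t hx)).congr_deriv ?_
    rw [eval_mul, eval_X]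
    ring
  have h := intervalIntegral.integral_eq_sub_of_hasDerivAt_of_le (by norm_num) hcont hderiv
    ((i1.sub i2).sub i3)
  have hb : weight (α + 1) t 1 = 0 := by
    have : α + 1 ≠ 0 := by linarith
    simp [weight, Real.zero_rpow this]
  have hb' : weight (α + 1) t (-1) = 0 := by rw [weight_neg, hb]
  rw [intervalIntegral.integral_sub (i1.sub i2) i3, intervalIntegral.integral_sub i1 i2,
    intervalIntegral.integral_const_mul, intervalIntegral.integral_const_mul, hb, hb'] at h
  simp only [weightFunctional_apply]
  linarith

theorem isPearson_weightFunctional {α : ℝ} (hα : -1 < α) (t : ℝ) :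
    IsPearson α t (weightFunctional hα t) := by
  intro Q
  have hα' : -1 < α + 1 := by linarith
  have h := weightFunctional_derivative hα hα' t Q
  rw [weightFunctional_add_one hα hα', weightFunctional_add_one hα hα', ← apply_C_mul,
    ← apply_C_mul, ← map_add] at h
  rw [h]
  congr 1
  rw [add_comm α 1]
  ring

theorem isMonicOrthogonal_iff {α : ℝ} (hα : -1 < α) (t : ℝ) (P : ℕ → ℝ[X]) :
    IsMonicOrthogonal α t P ↔ P = orthPoly (weightFunctional hα t) := by
  have hL := isSymmetricPositive_weightFunctional hα t
  have key : ∀ p q : ℝ[X], ∫ x in (-1 : ℝ)..1, p.eval x * q.eval x * weight α t x =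
      weightFunctional hα t (p * q) := fun p q => by simp [weightFunctional_apply]
  constructor
  · rintro ⟨h1, h2⟩
    exact hL.eq_orthPoly h1 (fun m n hmn => by rw [← key, h2 m n hmn])
  · rintro rfl
    exact ⟨orthPoly_monic_natDegree _, fun m n hmn => by
      rw [key, hL.apply_mul_orthPoly_of_ne hmn]⟩

theorem normSq_orthPoly {α : ℝ} (hα : -1 < α) (t : ℝ) (n : ℕ) :
    normSq α t (orthPoly (weightFunctional hα t)) n = orthNorm (weightFunctional hα t) n := by
  simp [normSq, orthNorm, weightFunctional_apply, sq]

/-! ### The quantities `Rₙ` for positive `α` -/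

theorem auxR_integrand_eq (α t : ℝ) (p : ℝ[X]) {x : ℝ} (hx : x ∈ Set.Ioo (-1 : ℝ) 1) :
    (p * p).eval x * weight (α - 1) t x = 1 / (1 - x ^ 2) * p.eval x ^ 2 * weight α t x := by
  have h := weight_add_one (α - 1) t hx
  rw [sub_add_cancel] at h
  have := (one_sub_sq_pos hx).ne'
  rw [h, eval_mul]
  field_simp

theorem intervalIntegrable_auxR {α : ℝ} (hα : 0 < α) (t : ℝ) (p : ℝ[X]) :
    IntervalIntegrable (fun y : ℝ => 1 / (1 - y ^ 2) * p.eval y ^ 2 * weight α t y)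
      volume (-1) 1 :=
  intervalIntegrable_congr_Ioo (fun _ hx => auxR_integrand_eq α t p hx)
    (intervalIntegrable_mul_weight (by linarith) t (p * p).continuous)

/-- Integrating `(x Pₙ² w)'` identifies `Rₙ` with an expression in the recurrence coefficients.
The factor `1 / (1 - y²)` lowers `α` by one, so this is `weightFunctional_derivative` at
`α - 1 > -1`. -/
theorem auxR_eq_coeffR {α : ℝ} (hα : -1 < α) (h0 : 0 < α) (t : ℝ) (n : ℕ) :
    auxR α t (orthPoly (weightFunctional hα t)) n =
      coeffR α t (recCoeff (weightFunctional hα t)) n := by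
  obtain ⟨γ, rfl⟩ : ∃ γ, α = γ + 1 := ⟨α - 1, by ring⟩
  have hγ : -1 < γ := by linarith
  have hL := isSymmetricPositive_weightFunctional hα t
  set L := weightFunctional hα t with hLdef
  set p := orthPoly L n with hp
  have hint : ∫ y in (-1 : ℝ)..1, 1 / (1 - y ^ 2) * p.eval y ^ 2 * weight (γ + 1) t y =
      weightFunctional hγ t (p * p) := by
    rw [weightFunctional_apply]
    refine (integral_congr_Ioo (fun x hx => ?_)).symm
    have := auxR_integrand_eq (γ + 1) t p hx
    rwa [add_sub_cancel_right] at this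
  have hibp := weightFunctional_derivative hγ hα t (X * (p * p))
  have e1 : derivative (X * (p * p)) = p * p + C 2 * (X * derivative p * p) := by
    simp only [derivative_mul, derivative_X, C_ofNat]; ring
  have e2 : X * (X * (p * p)) = X ^ 2 * (p * p) := by ring
  have e3 : weightFunctional hγ t (X ^ 2 * (p * p)) =
      weightFunctional hγ t (p * p) - L (p * p) := by
    rw [hLdef, weightFunctional_add_one hγ hα, ← map_sub]
    congr 1; ring
  rw [e1, e2, e3, ← hLdef, map_add, apply_C_mul, hL.apply_X_mul_derivative_self,
    hL.apply_X_sq_mul_orthPoly_sq] at hibp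
  have hn : L (p * p) = orthNorm L n := rfl
  rw [hn] at hibp
  have hpos := hL.orthNorm_pos n
  rw [auxR, hLdef, normSq_orthPoly, ← hLdef, ← hp, hint, coeffR]
  field_simp
  linear_combination -hibp

/-! ### Dependence on `t` and the Hankel determinant -/

/-- `d/dt ∫ p w(x, t) dx = -∫ x² p w(x, t) dx`, by dominated convergence. -/
theorem hasDerivAt_weightFunctional {α : ℝ} (hα : -1 < α) (t : ℝ) (p : ℝ[X]) :
    HasDerivAt (fun s => weightFunctional hα s p) (-weightFunctional hα t (X ^ 2 * p)) t := by
  have hb : Continuous fun x : ℝ => |(X ^ 2 * p).eval x| * Real.exp (|t| + 1) :=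
    (X ^ 2 * p).continuous.abs.mul continuous_const
  have hmeas : AEStronglyMeasurable (fun x => -((X ^ 2 * p).eval x * weight α t x))
      (volume.restrict (Set.uIoc (-1) 1)) :=
    (intervalIntegrable_mul_weight hα t (X ^ 2 * p).continuous).def'.aestronglyMeasurable.neg
  have h := (intervalIntegral.hasDerivAt_integral_of_dominated_loc_of_deriv_le
    (F := fun s x => p.eval x * weight α s x)
    (F' := fun s x => -((X ^ 2 * p).eval x * weight α s x))
    (bound := fun x => |(X ^ 2 * p).eval x| * Real.exp (|t| + 1) * weight α 0 x)
    (Metric.ball_mem_nhds t one_pos)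
    (Filter.Eventually.of_forall fun s =>
      (intervalIntegrable_mul_weight hα s p.continuous).def'.aestronglyMeasurable)
    (intervalIntegrable_mul_weight hα t p.continuous)
    hmeas ?_ (intervalIntegrable_mul_weight hα 0 hb) ?_).2
  · simpa [weightFunctional_apply] using h
  · refine Filter.Eventually.of_forall fun x hx s hs => ?_
    rw [Set.uIoc_of_le (by norm_num : (-1 : ℝ) ≤ 1)] at hx
    have hw := weight_nonneg α 0 (x := x) ⟨hx.1.le, hx.2⟩
    rw [norm_neg, norm_mul, weight_eq_mul_exp, Real.norm_eq_abs, Real.norm_eq_abs, abs_mul,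
      abs_of_nonneg hw, Real.abs_exp, ← mul_assoc]
    refine mul_le_mul_of_nonneg_right (mul_le_mul_of_nonneg_left ?_ (abs_nonneg _)) hw
    refine Real.exp_le_exp.2 ?_
    have hs' : |s| ≤ |t| + 1 := by
      have h1 : |s - t| < 1 := by simpa [Real.dist_eq] using hs
      have h2 := abs_sub_abs_le_abs_sub s t
      linarith
    have hx2 : x ^ 2 ≤ 1 := by nlinarith [hx.1, hx.2]
    calc -s * x ^ 2 ≤ |s| * x ^ 2 := mul_le_mul_of_nonneg_right (neg_le_abs s) (sq_nonneg x)
      _ ≤ |s| * 1 := mul_le_mul_of_nonneg_left hx2 (abs_nonneg s)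
      _ ≤ |t| + 1 := by linarith
  · refine Filter.Eventually.of_forall fun x _ s _ => ?_
    have h1 : HasDerivAt (fun y : ℝ => Real.exp (-y * x ^ 2))
        (Real.exp (-s * x ^ 2) * (-1 * x ^ 2)) s :=
      ((hasDerivAt_id s).neg.mul_const (x ^ 2)).exp
    refine ((h1.const_mul ((1 - x ^ 2) ^ α)).const_mul (p.eval x)).congr_deriv ?_
    simp only [weight, eval_mul, eval_pow, eval_X]
    ring

/-- At a point where a matrix-valued function is diagonal, the derivative of its determinant
involves the diagonal entries only. -/
theorem hasDerivAt_det_of_diagonal {n : ℕ} {M : ℝ → Matrix (Fin n) (Fin n) ℝ}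
    {M' : Matrix (Fin n) (Fin n) ℝ} {d : Fin n → ℝ} {t : ℝ}
    (hM : ∀ i j, HasDerivAt (fun s => M s i j) (M' i j) t) (hd : M t = Matrix.diagonal d) :
    HasDerivAt (fun s => (M s).det) (∑ i, (∏ j ∈ Finset.univ.erase i, d j) * M' i i) t := by
  have h : HasDerivAt (fun s => (M s).det)
      (∑ σ : Equiv.Perm (Fin n), ((Equiv.Perm.sign σ : ℤ) : ℝ) *
        ∑ i, (∏ j ∈ Finset.univ.erase i, M t (σ j) j) * M' (σ i) i) t := by
    simp only [Matrix.det_apply']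
    refine HasDerivAt.fun_sum fun σ _ => HasDerivAt.const_mul _ ?_
    simpa using HasDerivAt.fun_finsetProd (u := Finset.univ) fun i _ => hM (σ i) i
  refine h.congr_deriv ?_
  rw [Finset.sum_eq_single 1]
  · simp [hd]
  · intro σ _ hσ
    refine mul_eq_zero_of_right _ (Finset.sum_eq_zero fun i _ => ?_)
    -- a nontrivial permutation moves at least two points, one of them other than `i`
    obtain ⟨j, hji, hj⟩ : ∃ j, j ≠ i ∧ σ j ≠ j := by
      by_contra! hcon
      refine hσ (Equiv.ext fun j => ?_)
      by_cases hji : j = i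
      · subst hji
        by_contra hne
        exact hne (σ.injective (hcon _ hne))
      · exact hcon j hji
    rw [Finset.prod_eq_zero (Finset.mem_erase.2 ⟨hji, Finset.mem_univ j⟩), zero_mul]
    rw [hd, Matrix.diagonal_apply_ne _ hj]
  · simp

/-- A unitriangular change of basis does not alter the Hankel determinant. -/
theorem hankelDet_eq_det {α : ℝ} (hα : -1 < α) (s : ℝ) {P : ℕ → ℝ[X]}
    (hP : ∀ n, (P n).Monic ∧ (P n).natDegree = n) (n : ℕ) :
    hankelDet α n s =
      (Matrix.of fun i j : Fin n => weightFunctional hα s (P i * P j)).det := by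
  set A : Matrix (Fin n) (Fin n) ℝ := Matrix.of fun i j : Fin n => (P j).coeff i with hA
  have hdet : A.det = 1 :=
    Matrix.det_matrixOfPolynomials (fun j : Fin n => P j) (fun i => (hP i).2) (fun i => (hP i).1)
  have hexp : ∀ j : Fin n, P j = ∑ k : Fin n, C ((P j).coeff k) * X ^ (k : ℕ) := fun j => by
    rw [Fin.sum_univ_eq_sum_range (fun k => C ((P j).coeff k) * X ^ k)]
    exact as_sum_range_C_mul_X_pow' _ (by rw [(hP j).2]; exact j.2)
  have hmul : (Matrix.of fun i j : Fin n => weightFunctional hα s (P i * P j)) =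
      A.transpose * (Matrix.of fun j k : Fin n => moment α s ((j : ℕ) + (k : ℕ))) * A := by
    ext i j
    rw [Matrix.of_apply, hexp i, hexp j, Finset.sum_mul_sum, map_sum, Matrix.mul_apply]
    simp only [map_sum, Matrix.mul_apply, Matrix.transpose_apply, Matrix.of_apply, hA,
      Finset.sum_mul]
    rw [Finset.sum_comm]
    refine Finset.sum_congr rfl fun k _ => Finset.sum_congr rfl fun l _ => ?_
    have e : C ((P i).coeff l) * X ^ (l : ℕ) * (C ((P j).coeff k) * X ^ (k : ℕ)) =
        C ((P i).coeff l) * (C ((P j).coeff k) * X ^ ((l : ℕ) + (k : ℕ))) := by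
      rw [pow_add]; ring
    rw [e, apply_C_mul, apply_C_mul, weightFunctional_X_pow]
    ring
  rw [hmul, Matrix.det_mul, Matrix.det_mul, Matrix.det_transpose, hdet, one_mul, mul_one]
  rfl

theorem gram_orthPoly {L : ℝ[X] →ₗ[ℝ] ℝ} (hL : IsSymmetricPositive L) (n : ℕ) :
    (Matrix.of fun i j : Fin n => L (orthPoly L i * orthPoly L j)) =
      Matrix.diagonal fun i : Fin n => orthNorm L i := by
  ext i j
  rw [Matrix.of_apply]
  rcases eq_or_ne i j with rfl | hij
  · rw [Matrix.diagonal_apply_eq, orthNorm]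
  · rw [Matrix.diagonal_apply_ne _ hij, hL.apply_mul_orthPoly_of_ne (fun h => hij (Fin.ext h))]

theorem hankelDet_eq_prod {α : ℝ} (hα : -1 < α) (t : ℝ) (n : ℕ) :
    hankelDet α n t = ∏ j : Fin n, orthNorm (weightFunctional hα t) j := by
  rw [hankelDet_eq_det hα t (orthPoly_monic_natDegree (weightFunctional hα t)),
    gram_orthPoly (isSymmetricPositive_weightFunctional hα t), Matrix.det_diagonal]

theorem hankelDet_pos {α : ℝ} (hα : -1 < α) (t : ℝ) (n : ℕ) : 0 < hankelDet α n t := by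
  rw [hankelDet_eq_prod hα]
  exact Finset.prod_pos fun j _ => (isSymmetricPositive_weightFunctional hα t).orthNorm_pos j

/-- In the basis of the polynomials orthogonal at the fixed time `t`, the Gram matrix is diagonal
at `t`, and only `d/ds ∫ Pⱼ² w(x, s) dx = -(βⱼ + βⱼ₊₁) hⱼ` contributes. -/
theorem hasDerivAt_hankelDet {α : ℝ} (hα : -1 < α) (t : ℝ) (n : ℕ) :
    HasDerivAt (hankelDet α n) (-hankelDet α n t * ∑ j ∈ Finset.range n,
      (recCoeff (weightFunctional hα t) j + recCoeff (weightFunctional hα t) (j + 1))) t := by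
  have hL := isSymmetricPositive_weightFunctional hα t
  set L := weightFunctional hα t with hLdef
  have h := hasDerivAt_det_of_diagonal
    (M := fun s => Matrix.of fun i j : Fin n =>
      weightFunctional hα s (orthPoly L i * orthPoly L j))
    (M' := Matrix.of fun i j : Fin n => -L (X ^ 2 * (orthPoly L i * orthPoly L j)))
    (fun i j => hasDerivAt_weightFunctional hα t (orthPoly L i * orthPoly L j))
    (gram_orthPoly hL n)
  have hfun : hankelDet α n = fun s => (Matrix.of fun i j : Fin n =>
      weightFunctional hα s (orthPoly L i * orthPoly L j)).det :=
    funext fun s => hankelDet_eq_det hα s (orthPoly_monic_natDegree L) n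
  rw [← hfun] at h
  refine h.congr_deriv ?_
  rw [hankelDet_eq_prod hα, ← hLdef, Finset.mul_sum, ← Fin.sum_univ_eq_sum_range (fun j =>
    -(∏ j : Fin n, orthNorm L j) * (recCoeff L j + recCoeff L (j + 1)))]
  refine Finset.sum_congr rfl fun i _ => ?_
  rw [Matrix.of_apply, hL.apply_X_sq_mul_orthPoly_sq,
    ← Finset.prod_erase_mul Finset.univ _ (Finset.mem_univ i)]
  ring

theorem logDerivH_eq_sum {α : ℝ} (hα : -1 < α) (t : ℝ) (n : ℕ) :
    logDerivH α t n =
      ∑ j ∈ Finset.range n, coeffR α t (recCoeff (weightFunctional hα t)) j := by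
  have hpos := hankelDet_pos hα t n
  have hder : deriv (fun s => Real.log (hankelDet α n s)) t = -∑ j ∈ Finset.range n,
      (recCoeff (weightFunctional hα t) j + recCoeff (weightFunctional hα t) (j + 1)) := by
    rw [((hasDerivAt_hankelDet hα t n).log hpos.ne').deriv]
    field_simp
  rw [logDerivH, hder, sum_coeffR rfl, Finset.sum_add_distrib]
  have : ∑ j ∈ Finset.range n, recCoeff (weightFunctional hα t) (j + 1) =
      ∑ j ∈ Finset.range n, recCoeff (weightFunctional hα t) j +
        recCoeff (weightFunctional hα t) n := by
    have h := Finset.sum_range_succ' (recCoeff (weightFunctional hα t)) n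
    rw [Finset.sum_range_succ] at h
    simpa [recCoeff] using h.symm
  rw [this]
  ring

/-! ### Kummer functions -/

/-- The term of index `k` in the Kummer series. -/
noncomputable def kummerTerm (a b z : ℝ) (k : ℕ) : ℝ :=
  (ascPochhammer ℝ k).eval a / (ascPochhammer ℝ k).eval b * (z ^ k / (k.factorial : ℝ))

theorem ascPochhammer_eval_succ_left (k : ℕ) (a : ℝ) :
    (ascPochhammer ℝ (k + 1)).eval a = a * (ascPochhammer ℝ k).eval (a + 1) := by
  simp [ascPochhammer_succ_left]

theorem ascPochhammer_eval_ne_zero {b : ℝ} (hb : ∀ k : ℕ, b ≠ -(k : ℝ)) (k : ℕ) :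
    (ascPochhammer ℝ k).eval b ≠ 0 := by
  induction k with
  | zero => simp
  | succ k ih =>
    rw [ascPochhammer_succ_eval]
    exact mul_ne_zero ih fun h => hb k (by linarith)

/-- A contiguous relation: `b Φ(a, b) = b Φ(a, b + 1) + z a / (b + 1) Φ(a + 1, b + 2)`. -/
theorem kummer_contiguous {a b : ℝ} (z : ℝ) (hb : ∀ k : ℕ, b ≠ -(k : ℝ)) :
    b * kummer a b z =
      b * kummer a (b + 1) z + z * (a / (b + 1)) * kummer (a + 1) (b + 2) z := by
  have hb1 : ∀ k : ℕ, b + 1 ≠ -(k : ℝ) := fun k h => hb (k + 1) (by push_cast; linarith)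
  have hb2 : ∀ k : ℕ, b + 2 ≠ -(k : ℝ) := fun k h => hb (k + 2) (by push_cast; linarith)
  have s0 : Summable (kummerTerm a b z) := summable_kummer a b z hb
  have s1 : Summable (kummerTerm a (b + 1) z) := summable_kummer a (b + 1) z hb1
  have s2 : Summable (kummerTerm (a + 1) (b + 2) z) := summable_kummer (a + 1) (b + 2) z hb2
  change b * ∑' k, kummerTerm a b z k = b * ∑' k, kummerTerm a (b + 1) z k +
    z * (a / (b + 1)) * ∑' k, kummerTerm (a + 1) (b + 2) z k
  -- the last series is shifted by one index to match the powers of `z`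
  rw [s0.tsum_eq_zero_add, s1.tsum_eq_zero_add, ← tsum_mul_left (a := z * (a / (b + 1)))]
  have h0 : kummerTerm a b z 0 = 1 := by simp [kummerTerm]
  have h1 : kummerTerm a (b + 1) z 0 = 1 := by simp [kummerTerm]
  rw [h0, h1, mul_add, mul_add, ← tsum_mul_left, ← tsum_mul_left, add_assoc,
    ← Summable.tsum_add (((summable_nat_add_iff 1).2 s1).mul_left b) (s2.mul_left _)]
  congr 1
  refine tsum_congr fun k => ?_
  have hb0 : b ≠ 0 := by simpa using hb 0
  have hb1' : b + 1 ≠ 0 := by simpa using hb1 0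
  have hp := ascPochhammer_eval_ne_zero hb2 k
  have hk : b + 1 + k ≠ 0 := fun h => hb1 k (by linarith)
  have hfac : (k.factorial : ℝ) ≠ 0 := by exact_mod_cast k.factorial_ne_zero
  have hk1 : (k : ℝ) + 1 ≠ 0 := by positivity
  have hshift : (b + 1) * (ascPochhammer ℝ k).eval (b + 2) =
      (ascPochhammer ℝ k).eval (b + 1) * (b + 1 + k) := by
    rw [← ascPochhammer_succ_eval, ascPochhammer_eval_succ_left]
    ring_nf
  have hp1 := ascPochhammer_eval_ne_zero hb1 k
  simp only [kummerTerm, ascPochhammer_eval_succ_left, Nat.factorial_succ, pow_succ]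
  rw [show b + 1 + 1 = b + 2 by ring]
  have hq : (ascPochhammer ℝ k).eval (b + 1) =
      (b + 1) * (ascPochhammer ℝ k).eval (b + 2) / (b + 1 + k) := by
    rw [hshift]; field_simp
  rw [hq]
  push_cast
  field_simp
  ring

/-- The recursion for the even moments at `t = 0`, from the Pearson identity for `x²ᵏ⁺¹`. -/
theorem moment_zero_succ {α : ℝ} (hα : -1 < α) (k : ℕ) :
    ((k : ℝ) + α + 3 / 2) * moment α 0 (2 * k + 2) = ((k : ℝ) + 1 / 2) * moment α 0 (2 * k) := by
  have h := isPearson_weightFunctional hα 0 (X ^ (2 * k + 1))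
  have e1 : (1 - X ^ 2) * derivative (X ^ (2 * k + 1) : ℝ[X]) =
      C (2 * (k : ℝ) + 1) * X ^ (2 * k) - C (2 * (k : ℝ) + 1) * X ^ (2 * k + 2) := by
    rw [derivative_X_pow]
    simp
    ring
  have e2 : (C (2 * (1 + α)) * X + C (2 * 0) * X * (1 - X ^ 2)) * X ^ (2 * k + 1) =
      C (2 * (1 + α)) * X ^ (2 * k + 2) := by
    rw [mul_zero, C_0]; ring
  rw [e1, e2, map_sub, apply_C_mul, apply_C_mul, apply_C_mul, weightFunctional_X_pow,
    weightFunctional_X_pow] at h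
  linear_combination -h / 2

theorem moment_even_pos {α : ℝ} (hα : -1 < α) (t : ℝ) (k : ℕ) : 0 < moment α t (2 * k) := by
  rw [← weightFunctional_X_pow hα, two_mul, pow_add]
  exact (isSymmetricPositive_weightFunctional hα t).pos _ (pow_ne_zero _ X_ne_zero)

/-- `μ₂₍ₘ₊ₖ₎(0) / μ₂ₘ(0) = (m + 1/2)ₖ / (m + 3/2 + α)ₖ`, so no closed form of `μ₂ₘ(0)` is needed. -/
theorem moment_zero_add {α : ℝ} (hα : -1 < α) (m k : ℕ) :
    moment α 0 (2 * (m + k)) = moment α 0 (2 * m) *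
      ((ascPochhammer ℝ k).eval ((m : ℝ) + 1 / 2) /
        (ascPochhammer ℝ k).eval ((m : ℝ) + 3 / 2 + α)) := by
  have hb : ∀ k : ℕ, (m : ℝ) + 3 / 2 + α ≠ -(k : ℝ) := fun k h => by
    have h1 : (0 : ℝ) ≤ m := by positivity
    have h2 : (0 : ℝ) ≤ k := by positivity
    linarith
  induction k with
  | zero => simp
  | succ k ih =>
    have h := moment_zero_succ hα (m + k)
    have h1 := ascPochhammer_eval_ne_zero hb k
    have h2 : (m : ℝ) + 3 / 2 + α + k ≠ 0 := fun h => hb k (by linarith)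
    rw [show 2 * (m + k) + 2 = 2 * (m + (k + 1)) by ring, ih] at h
    rw [ascPochhammer_succ_eval, ascPochhammer_succ_eval]
    push_cast at h
    rw [show (m : ℝ) + k + α + 3 / 2 = m + 3 / 2 + α + k by ring] at h
    generalize (m : ℝ) + 3 / 2 + α = b at *
    refine mul_left_cancel₀ h2 ?_
    rw [h]
    field_simp
    ring

/-- Expanding `exp (-t x²)` under the integral writes the even moments as Kummer functions. -/
theorem moment_eq_kummer {α : ℝ} (hα : -1 < α) (t : ℝ) (m : ℕ) :
    moment α t (2 * m) =
      moment α 0 (2 * m) * kummer ((m : ℝ) + 1 / 2) ((m : ℝ) + 3 / 2 + α) (-t) := by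
  have hsum := intervalIntegral.hasSum_integral_of_dominated_convergence
    (μ := volume) (a := -1) (b := 1)
    (F := fun (k : ℕ) x => (-t) ^ k / (k.factorial : ℝ) * (x ^ (2 * (m + k)) * weight α 0 x))
    (f := fun x => x ^ (2 * m) * weight α t x)
    (fun k x => |t| ^ k / (k.factorial : ℝ) * weight α 0 x)
    (fun k => ((intervalIntegrable_mul_weight hα 0
      (continuous_pow (2 * (m + k)))).const_mul _).def'.aestronglyMeasurable)
    ?_ ?_ ?_ ?_
  · have hval : ∀ k : ℕ, ∫ x in (-1 : ℝ)..1,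
        (-t) ^ k / (k.factorial : ℝ) * (x ^ (2 * (m + k)) * weight α 0 x) =
        moment α 0 (2 * m) * kummerTerm ((m : ℝ) + 1 / 2) ((m : ℝ) + 3 / 2 + α) (-t) k := by
      intro k
      rw [intervalIntegral.integral_const_mul]
      change _ * moment α 0 (2 * (m + k)) = _
      rw [moment_zero_add hα, kummerTerm]
      ring
    simp only [hval] at hsum
    rw [moment, ← hsum.tsum_eq, tsum_mul_left]
    rfl
  · refine fun k => Filter.Eventually.of_forall fun x hx => ?_
    rw [Set.uIoc_of_le (by norm_num : (-1 : ℝ) ≤ 1)] at hx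
    have hw := weight_nonneg α 0 (x := x) ⟨hx.1.le, hx.2⟩
    rw [Real.norm_eq_abs, abs_mul, abs_mul, abs_of_nonneg hw, abs_div, abs_pow, abs_neg,
      Nat.abs_cast]
    refine mul_le_mul_of_nonneg_left ?_ (by positivity)
    refine mul_le_of_le_one_left hw ?_
    rw [abs_pow]
    exact pow_le_one₀ (abs_nonneg x) (abs_le.2 ⟨hx.1.le, hx.2⟩)
  · exact Filter.Eventually.of_forall fun x _ =>
      (Real.summable_pow_div_factorial |t|).mul_right _
  · simp only [tsum_mul_right]
    exact (intervalIntegrable_weight hα 0).const_mul _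
  · refine Filter.Eventually.of_forall fun x _ => ?_
    have h := (NormedSpace.expSeries_div_hasSum_exp (-t * x ^ 2)).mul_left
      (x ^ (2 * m) * weight α 0 x)
    rw [← Real.exp_eq_exp_ℝ] at h
    have e : x ^ (2 * m) * weight α t x =
        x ^ (2 * m) * weight α 0 x * Real.exp (-t * x ^ 2) := by
      rw [weight_eq_mul_exp α t]; ring
    rw [e]
    refine h.congr_fun fun k => ?_
    rw [mul_pow]
    ring

theorem kummer_pos {α : ℝ} (hα : -1 < α) (t : ℝ) (m : ℕ) :
    0 < kummer ((m : ℝ) + 1 / 2) ((m : ℝ) + 3 / 2 + α) (-t) := by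
  have h := moment_even_pos hα t m
  rw [moment_eq_kummer hα] at h
  exact pos_of_mul_pos_right h (moment_even_pos hα 0 m).le

/-- `2 m + 1 + 2 α - 2 t μ₂ₘ₊₂ / μ₂ₘ` as a quotient of Kummer functions. -/
theorem moment_quotient_eq_kummer {α : ℝ} (hα : -1 < α) (t : ℝ) (m : ℕ)
    (hb : ∀ k : ℕ, (m : ℝ) + 1 / 2 + α ≠ -(k : ℝ)) :
    2 * m + 1 + 2 * α - 2 * t * (moment α t (2 * (m + 1)) / moment α t (2 * m)) =
      (2 * m + 1 + 2 * α) * kummer ((m : ℝ) + 1 / 2) ((m : ℝ) + 1 / 2 + α) (-t) /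
        kummer ((m : ℝ) + 1 / 2) ((m : ℝ) + 3 / 2 + α) (-t) := by
  have hc := kummer_contiguous (a := (m : ℝ) + 1 / 2) (-t) hb
  rw [show (m : ℝ) + 1 / 2 + α + 1 = m + 3 / 2 + α by ring,
    show (m : ℝ) + 1 / 2 + α + 2 = m + 5 / 2 + α by ring,
    show (m : ℝ) + 1 / 2 + 1 = m + 3 / 2 by ring] at hc
  have hK := (kummer_pos hα t m).ne'
  have h0 := (moment_even_pos hα 0 m).ne'
  have hr := moment_zero_succ hα m
  have hm1 := moment_eq_kummer hα t (m + 1)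
  push_cast at hm1
  rw [show (m : ℝ) + 1 + 1 / 2 = m + 3 / 2 by ring,
    show (m : ℝ) + 1 + 3 / 2 + α = m + 5 / 2 + α by ring] at hm1
  have hpos : (m : ℝ) + 3 / 2 + α ≠ 0 := by
    have : (0 : ℝ) ≤ m := by positivity
    intro h; linarith
  have hr' : moment α 0 (2 * (m + 1)) =
      ((m : ℝ) + 1 / 2) / (m + 3 / 2 + α) * moment α 0 (2 * m) := by
    rw [mul_add, mul_one, div_mul_eq_mul_div, eq_div_iff hpos]
    linear_combination hr
  rw [hm1, moment_eq_kummer hα t m, hr']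
  rw [eq_div_iff hK]
  have hq : ((m : ℝ) + 1 / 2) / (m + 3 / 2 + α) * moment α 0 (2 * m) *
      kummer (m + 3 / 2) (m + 5 / 2 + α) (-t) /
      (moment α 0 (2 * m) * kummer (m + 1 / 2) (m + 3 / 2 + α) (-t)) *
      kummer (m + 1 / 2) (m + 3 / 2 + α) (-t) = ((m : ℝ) + 1 / 2) / (m + 3 / 2 + α) *
      kummer (m + 3 / 2) (m + 5 / 2 + α) (-t) := by
    generalize kummer ((m : ℝ) + 1 / 2) (m + 3 / 2 + α) (-t) = K at *
    generalize kummer ((m : ℝ) + 3 / 2) (m + 5 / 2 + α) (-t) = K'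
    field_simp
  linear_combination -2 * hc - 2 * t * hq

/-- Since `P₀ = 1` and `P₁ = x`, `Rₘ` for `m ≤ 1` involves the moments only. -/
theorem coeffR_eq_kummer {α : ℝ} (hα : -1 < α) (t : ℝ) {m : ℕ} (hm : m ≤ 1)
    (hb : ∀ k : ℕ, (m : ℝ) + 1 / 2 + α ≠ -(k : ℝ)) :
    coeffR α t (recCoeff (weightFunctional hα t)) m =
      (2 * m + 1 + 2 * α) * kummer ((m : ℝ) + 1 / 2) ((m : ℝ) + 1 / 2 + α) (-t) /
        kummer ((m : ℝ) + 1 / 2) ((m : ℝ) + 3 / 2 + α) (-t) := by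
  have hL := isSymmetricPositive_weightFunctional hα t
  have hP : orthPoly (weightFunctional hα t) m = X ^ m := by
    interval_cases m <;> simp [orthPoly]
  have h := hL.apply_X_sq_mul_orthPoly_sq m
  rw [orthNorm, hP, ← pow_add, ← pow_add, weightFunctional_X_pow, weightFunctional_X_pow,
    show 2 + (m + m) = 2 * (m + 1) by ring, show m + m = 2 * m by ring] at h
  rw [← moment_quotient_eq_kummer hα t m hb, h, coeffR,
    mul_div_cancel_right₀ _ (moment_even_pos hα t m).ne']

end SemiJacobi

open SemiJacobi in
theorem mainTheorem6 (α : ℝ) (hα : -1 < α) (t : ℝ) :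
    -- the objects involved are well defined, and both readings of `H` agree when `0 < α`
    (∃! P : ℕ → ℝ[X], SemiJacobi.IsMonicOrthogonal α t P) ∧
    (∀ P : ℕ → ℝ[X], SemiJacobi.IsMonicOrthogonal α t P → ∀ n : ℕ,
      0 < SemiJacobi.normSq α t P n ∧
      (0 < α → IntervalIntegrable
        (fun y : ℝ => 1 / (1 - y ^ 2) * (P n).eval y ^ 2 * SemiJacobi.weight α t y)
        volume (-1) 1 ∧
        SemiJacobi.sumR α t P n = SemiJacobi.logDerivH α t n)) ∧
    (∀ n : ℕ, 0 < SemiJacobi.hankelDet α n t ∧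
      DifferentiableAt ℝ (SemiJacobi.hankelDet α n) t) ∧
    SemiJacobi.kummer (1 / 2) (3 / 2 + α) (-t) ≠ 0 ∧
    SemiJacobi.kummer (3 / 2) (5 / 2 + α) (-t) ≠ 0 ∧
    -- the difference equation and its initial values
    ∀ H : ℕ → ℝ, SemiJacobi.IsHankelQuantity α t H →
      (∀ n : ℕ, 1 ≤ n →
        0 = (2 * t + H n - H (n - 1)) ^ 2 * (2 * t + H (n + 1) - H n) ^ 2
              * (H n + n * H (n - 1) - n * H (n + 1))
          + (n * (2 * t + H n - H (n - 1)) * (2 * t + H (n + 1) - H n)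
              - 2 * t * (2 * n * t + H n))
            * ((2 * t + H n - H (n - 1)) * (2 * t + H (n + 1) - H n)
                * (2 * t - n - 2 * α + H (n + 1) - H (n - 1))
              + 2 * t * (2 * n * t + H n))) ∧
      H 0 = 0 ∧
      (α ≠ -(1 / 2) →
        H 1 = (1 + 2 * α) * SemiJacobi.kummer (1 / 2) (1 / 2 + α) (-t)
            / SemiJacobi.kummer (1 / 2) (3 / 2 + α) (-t) ∧
        H 2 = (1 + 2 * α) * SemiJacobi.kummer (1 / 2) (1 / 2 + α) (-t)
              / SemiJacobi.kummer (1 / 2) (3 / 2 + α) (-t)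
            + (3 + 2 * α) * SemiJacobi.kummer (3 / 2) (3 / 2 + α) (-t)
              / SemiJacobi.kummer (3 / 2) (5 / 2 + α) (-t)) := by
  have hL := isSymmetricPositive_weightFunctional hα t
  have hsumR : 0 < α → ∀ n, sumR α t (orthPoly (weightFunctional hα t)) n = logDerivH α t n :=
    fun h0 n => by
      rw [logDerivH_eq_sum hα, sumR]
      exact Finset.sum_congr rfl fun j _ => auxR_eq_coeffR hα h0 t j
  have hK0 := kummer_pos hα t 0
  have hK1 := kummer_pos hα t 1
  norm_num at hK0 hK1
  refine ⟨⟨orthPoly (weightFunctional hα t), (isMonicOrthogonal_iff hα t _).2 rfl,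
    fun P hP => (isMonicOrthogonal_iff hα t P).1 hP⟩, ?_,
    fun n => ⟨hankelDet_pos hα t n, (hasDerivAt_hankelDet hα t n).differentiableAt⟩,
    hK0.ne', hK1.ne', ?_⟩
  · intro P hP n
    obtain rfl := (isMonicOrthogonal_iff hα t P).1 hP
    exact ⟨by rw [normSq_orthPoly]; exact hL.orthNorm_pos n,
      fun h0 => ⟨intervalIntegrable_auxR h0 t _, hsumR h0 n⟩⟩
  · intro H hH
    have hlog : ∀ n, H n = logDerivH α t n := by
      rcases hH with ⟨h0, P, hP, hH⟩ | hH
      · obtain rfl := (isMonicOrthogonal_iff hα t P).1 hP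
        exact fun n => by rw [hH, hsumR h0]
      · exact hH
    have hH' : ∀ n, H n =
        ∑ j ∈ Finset.range n, coeffR α t (recCoeff (weightFunctional hα t)) j :=
      fun n => by rw [hlog, logDerivH_eq_sum hα]
    refine ⟨difference_equation rfl (hL.string_equation (isPearson_weightFunctional hα t)) hH',
      by simp [hH'], fun hα2 => ?_⟩
    have hR0 := coeffR_eq_kummer hα t (m := 0) (by norm_num) (fun k hk => by
      rcases Nat.eq_zero_or_pos k with rfl | hpos
      · exact hα2 (by push_cast at hk; linarith)
      · have : (1 : ℝ) ≤ k := by exact_mod_cast hpos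
        push_cast at hk
        linarith)
    have hR1 := coeffR_eq_kummer hα t (m := 1) le_rfl (fun k hk => by
      have : (0 : ℝ) ≤ k := by positivity
      push_cast at hk
      linarith)
    rw [hH' 1, hH' 2, Finset.sum_range_one, Finset.sum_range_succ, Finset.sum_range_one, hR0, hR1]
    norm_num
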